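/- Let $s$ and $r$ be positive integers and let $k=s(r+1)$. For $n\ge 1$ let $P_{n,k,s}\subset\mathbb{R}^{s(n-1)+k}$ be the Minkowski sum of the $n$ simplices $\Delta_{\{si,\,si+1,\,\ldots,\,si+k-1\}}$, $i=0,\ldots,n-1$, where the canonical basis vectors $e_0,\ldots,e_{s(n-1)+k-1}$ are indexed from $0$ and $\Delta_I=\operatorname{conv}\{e_j : j\in I\}$. Let $b_n^{(k,s)}$ be the number of vertices of the polytope $P_{n,k,s}$. Then, as formal power series, $$ 1+\sum_{n\ge 1} b_n^{(k,s)}x^n=\frac{1+(rs-s-2)x-(rs-1)x^2+s\,x^{r+1}}{1-2(s+1)x+(s+1)^2x^2+s\,x^{r+1}-s^2(r+1)x^{r+2}+s(rs-1)x^{r+3}}. $$ In particular, if $s=1$ (so that $k=r+1$), then $$ 1+\sum_{n\ge 1} b_n^{(k,1)}x^n=\frac{1+(k-4)x-(k-2)x^2+x^k}{1-4x+4x^2+x^k-k\,x^{k+1}+(k-2)x^{k+2}}. $$ -/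

import Mathlib

open scoped Pointwise

/-- The simplex `Δ_I = conv {e_i : i ∈ I}` in `ℝ^d`, where `e_i` is the `i`-th canonical vector. -/
def simplexOn {d : ℕ} (I : Set (Fin d)) : Set (Fin d → ℝ) :=
  convexHull ℝ ((fun i => (Pi.single i 1 : Fin d → ℝ)) '' I)

/-- The `i`-th pooling window `{si, si+1, …, si+k-1}`, as a subset of the index set
`{0, …, d-1}`. -/
def poolWindow (d k s i : ℕ) : Set (Fin d) :=
  {j | s * i ≤ (j : ℕ) ∧ (j : ℕ) < s * i + k}

/-- The polytope `P_{n,k,s}` for `n ≥ 1`: the Minkowski sum (pointwise sum of sets) of the `n`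
simplices on the windows `{si, …, si+k-1}`, `i = 0, …, n-1`, in the space `ℝ^K` with
`K = s(n-1)+k`, whose coordinates are exactly those in the union of the windows. -/
def poolPolytope (n k s : ℕ) : Set (Fin (s * (n - 1) + k) → ℝ) :=
  ∑ i ∈ Finset.range n, simplexOn (poolWindow (s * (n - 1) + k) k s i)

/-- `b_n^{(k,s)}`, the number of vertices of `P_{n,k,s}`. A vertex of a polytope is a face
consisting of one point, that is, a point which is the unique maximizer over the polytope of some
linear functional; in Mathlib these are the exposed points. -/
noncomputable def numVertices (n k s : ℕ) : ℕ :=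
  ((poolPolytope n k s).exposedPoints ℝ).ncard

/-- The generating function `1 + ∑_{n ≥ 1} b_n^{(k,s)} x^n`, as a formal power series. -/
noncomputable def vertexGenFun (k s : ℕ) : PowerSeries ℚ :=
  PowerSeries.mk fun n => if n = 0 then 1 else (numVertices n k s : ℚ)

/-! A generic linear functional picks one basis vector from each window, so vertices correspond
bijectively to selections `c` whose entries are the strict maximizers of one common weight
(`mem_exposedPoints_sum_simplexOn`, `sum_single_injOn`). Realizability is a local condition: two
consecutive selections must agree, or one of them must lie outside the other's window. Necessity is
immediate; for sufficiency an explicit height function serves as the weight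
(`IsCompatible.exists_weight`).

Recording offsets within windows turns selections into walks of a fixed relation on `Fin k`. The
number of walks from `a` depends only on the block `a / s` (`walkCount_eq_levelCount`), which leaves
`r + 1` linear recurrences; eliminating all generating functions but that of block 0 gives the
fraction. -/

/-- `c` is the strict maximizer of the weight `w` on `I`. -/
def IsStrictMaximizer {d : ℕ} (w : Fin d → ℝ) (I : Set (Fin d)) (c : Fin d) : Prop :=
  c ∈ I ∧ ∀ j ∈ I, j ≠ c → w j < w c

/-! ### Vertices of a Minkowski sum of simplices -/

theorem simplexOn_subset {d : ℕ} (I : Set (Fin d)) :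
    simplexOn I ⊆ {y | (∀ j, 0 ≤ y j) ∧ ∑ j, y j = 1 ∧ ∀ j ∉ I, y j = 0} := by
  apply convexHull_min
  · rintro _ ⟨i, hi, rfl⟩
    refine ⟨fun j => ?_, by simp, fun j hj => ?_⟩
    · by_cases h : j = i
      · subst h; simp
      · simp [h]
    · have : j ≠ i := fun h => hj (h ▸ hi)
      simp [this]
  · rintro y ⟨hy0, hy1, hyI⟩ z ⟨hz0, hz1, hzI⟩ a b ha hb hab
    refine ⟨fun j => ?_, ?_, fun j hj => ?_⟩
    · have := hy0 j; have := hz0 j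
      simp only [Pi.add_apply, Pi.smul_apply, smul_eq_mul]
      positivity
    · simp [Finset.sum_add_distrib, ← Finset.mul_sum, hy1, hz1, hab]
    · simp [hyI j hj, hzI j hj]

theorem single_mem_simplexOn {d : ℕ} {I : Set (Fin d)} {i : Fin d} (hi : i ∈ I) :
    (Pi.single i 1 : Fin d → ℝ) ∈ simplexOn I :=
  subset_convexHull ℝ _ ⟨i, hi, rfl⟩

theorem sum_mul_le_of_mem_simplexOn {d : ℕ} {I : Set (Fin d)} {w y : Fin d → ℝ} {M : ℝ}
    (hM : ∀ j ∈ I, w j ≤ M) (hy : y ∈ simplexOn I) : ∑ j, w j * y j ≤ M := by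
  obtain ⟨h0, h1, hI⟩ := simplexOn_subset I hy
  calc ∑ j, w j * y j ≤ ∑ j, M * y j := by
        refine Finset.sum_le_sum fun j _ => ?_
        by_cases hj : j ∈ I
        · exact mul_le_mul_of_nonneg_right (hM j hj) (h0 j)
        · simp [hI j hj]
    _ = M := by rw [← Finset.mul_sum, h1, mul_one]

theorem IsStrictMaximizer.le {d : ℕ} {I : Set (Fin d)} {w : Fin d → ℝ} {c : Fin d}
    (h : IsStrictMaximizer w I c) : ∀ j ∈ I, w j ≤ w c := by
  intro j hj
  by_cases hc : j = c
  · rw [hc]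
  · exact (h.2 j hj hc).le

theorem IsStrictMaximizer.eq_single {d : ℕ} {I : Set (Fin d)} {w y : Fin d → ℝ} {c : Fin d}
    (h : IsStrictMaximizer w I c) (hy : y ∈ simplexOn I) (he : w c ≤ ∑ j, w j * y j) :
    y = Pi.single c 1 := by
  obtain ⟨h0, h1, hI⟩ := simplexOn_subset I hy
  have hnn : ∀ j ∈ Finset.univ, 0 ≤ (w c - w j) * y j := by
    intro j _
    by_cases hj : j ∈ I
    · exact mul_nonneg (sub_nonneg.2 (h.le j hj)) (h0 j)
    · simp [hI j hj]
  have hsum : ∑ j, (w c - w j) * y j = 0 := by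
    refine le_antisymm ?_ (Finset.sum_nonneg hnn)
    simp only [sub_mul, Finset.sum_sub_distrib, ← Finset.mul_sum, h1, mul_one]
    linarith
  have hz : ∀ j, j ≠ c → y j = 0 := by
    intro j hj
    by_cases hjI : j ∈ I
    · have := (Finset.sum_eq_zero_iff_of_nonneg hnn).1 hsum j (Finset.mem_univ j)
      rcases mul_eq_zero.1 this with h' | h'
      · linarith [h.2 j hjI hj]
      · exact h'
    · exact hI j hjI
  have hc : y c = 1 := by
    rw [← h1, Finset.sum_eq_single c (fun j _ hj => hz j hj) (by simp)]
  funext j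
  by_cases hj : j = c
  · subst hj; simp [hc]
  · simp [hj, hz j hj]

theorem dual_apply_eq_sum {d : ℕ} (l : StrongDual ℝ (Fin d → ℝ)) (y : Fin d → ℝ) :
    l y = ∑ j, l (Pi.single j 1) * y j := by
  have hy : y = ∑ j, y j • (Pi.single j 1 : Fin d → ℝ) := by
    funext t
    simp [Finset.sum_apply, Pi.single_apply]
  conv_lhs => rw [hy]
  simp [map_sum, mul_comm]

/-- The vertices of a Minkowski sum of simplices are the sums of basis vectors selected by some
weight which has a strict maximizer on every index set. -/
theorem mem_exposedPoints_sum_simplexOn {d : ℕ} {ι : Type*} [Fintype ι] {W : ι → Set (Fin d)}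
    (hW : ∀ i, (W i).Nonempty) (x : Fin d → ℝ) :
    x ∈ (∑ i, simplexOn (W i)).exposedPoints ℝ ↔
      ∃ c : ι → Fin d, (∃ w, ∀ i, IsStrictMaximizer w (W i) (c i)) ∧
        ∑ i, (Pi.single (c i) 1 : Fin d → ℝ) = x := by
  classical
  constructor
  · rintro ⟨hx, l, hl⟩
    set w : Fin d → ℝ := fun j => l (Pi.single j 1) with hw
    have hmax : ∀ i, ∃ c ∈ W i, ∀ j ∈ W i, w j ≤ w c := fun i =>
      Set.exists_max_image (W i) w (Set.toFinite _) (hW i)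
    choose c hcW hcmax using hmax
    -- Any choice of maximizers yields a point where `l` is at least `l x`, hence `x` itself by
    -- uniqueness.
    have key : ∀ c' : ι → Fin d, (∀ i, c' i ∈ W i) → (∀ i, w (c' i) = w (c i)) →
        ∑ i, (Pi.single (c' i) 1 : Fin d → ℝ) = x := by
      intro c' hc' hwc
      refine (hl _ ?_).2 ?_
      · exact Set.mem_finsetSum _ _ _ |>.2
          ⟨fun i => Pi.single (c' i) 1, fun {i} _ => single_mem_simplexOn (hc' i), rfl⟩
      · obtain ⟨g, hg, rfl⟩ := (Set.mem_finsetSum _ _ _).1 hx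
        rw [map_sum, map_sum]
        refine Finset.sum_le_sum fun i hi => ?_
        rw [dual_apply_eq_sum l (g i)]
        refine (sum_mul_le_of_mem_simplexOn (hcmax i) (hg hi)).trans ?_
        exact (hwc i).symm.le
    refine ⟨c, ⟨w, fun i => ⟨hcW i, fun j hj hjc => lt_of_le_of_ne (hcmax i j hj) fun hwj => ?_⟩⟩,
      key c hcW fun _ => rfl⟩
    -- A tie at `j` would let `j` replace `c i` without changing the sum, yet coordinate `j`
    -- changes.
    have h1 := key c hcW fun _ => rfl
    have h2 := key (Function.update c i j)
      (fun t => by by_cases h : t = i <;> [(subst h; simpa using hj); simpa [h] using hcW t])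
      (fun t => by by_cases h : t = i <;> [(subst h; simpa using hwj); simp [h]])
    rw [← h1, ← Finset.add_sum_erase _ _ (Finset.mem_univ i),
      ← Finset.add_sum_erase _ _ (Finset.mem_univ i)] at h2
    have h3 : ∑ t ∈ Finset.univ.erase i, (Pi.single (Function.update c i j t) 1 : Fin d → ℝ) =
        ∑ t ∈ Finset.univ.erase i, (Pi.single (c t) 1 : Fin d → ℝ) :=
      Finset.sum_congr rfl fun t ht => by
        rw [Function.update_of_ne (Finset.ne_of_mem_erase ht)]
    rw [h3] at h2
    have h4 := congrFun (add_right_cancel h2) j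
    simp [hjc] at h4
  · rintro ⟨c, ⟨w, hc⟩, rfl⟩
    refine ⟨(Set.mem_finsetSum _ _ _).2
      ⟨fun i => Pi.single (c i) 1, fun {i} _ => single_mem_simplexOn (hc i).1, rfl⟩, ?_⟩
    let l : StrongDual ℝ (Fin d → ℝ) :=
      ∑ j, w j • ContinuousLinearMap.proj (R := ℝ) (φ := fun _ : Fin d => ℝ) j
    have hl : ∀ y, l y = ∑ j, w j * y j := fun y => by simp [l]
    have hls : ∀ j, l (Pi.single j 1) = w j := fun j => by simp [hl, Pi.single_apply]
    refine ⟨l, fun y hy => ?_⟩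
    obtain ⟨g, hg, rfl⟩ := (Set.mem_finsetSum _ _ _).1 hy
    have hle : ∀ i ∈ Finset.univ, l (g i) ≤ w (c i) := fun i hi => by
      rw [hl]; exact sum_mul_le_of_mem_simplexOn (hc i).le (hg hi)
    simp only [map_sum, hls]
    refine ⟨Finset.sum_le_sum hle, fun h => ?_⟩
    have heq := (Finset.sum_eq_sum_iff_of_le hle).1 (le_antisymm (Finset.sum_le_sum hle) h)
    refine Finset.sum_congr rfl fun i hi => (hc i).eq_single (hg hi) ?_
    rw [← hl, heq i hi]

/-- Equal sums have equal total weight under `w`, while `c` beats `c'` termwise; so all terms tie,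
and strictness forces `c = c'`. Vertices can thus be counted as selections. -/
theorem sum_single_injOn {d : ℕ} {ι : Type*} [Fintype ι] (W : ι → Set (Fin d)) :
    Set.InjOn (fun c : ι → Fin d => ∑ i, (Pi.single (c i) 1 : Fin d → ℝ))
      {c | ∃ w, ∀ i, IsStrictMaximizer w (W i) (c i)} := by
  rintro c ⟨w, hc⟩ c' ⟨w', hc'⟩ h
  have hval : ∀ a : ι → Fin d,
      ∑ j, w j * (∑ i, (Pi.single (a i) 1 : Fin d → ℝ)) j = ∑ i, w (a i) := by
    intro a
    simp only [Finset.sum_apply, Finset.mul_sum]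
    rw [Finset.sum_comm]
    simp [Pi.single_apply]
  have hle : ∀ i ∈ Finset.univ, w (c' i) ≤ w (c i) := fun i _ => (hc i).le _ (hc' i).1
  have hs : ∑ i, w (c' i) = ∑ i, w (c i) := by
    rw [← hval, ← hval]; simp only at h; rw [h]
  have heq := (Finset.sum_eq_sum_iff_of_le hle).1 hs
  funext i
  by_contra hne
  exact ((hc i).2 _ (hc' i).1 (Ne.symm hne)).ne (heq i (Finset.mem_univ i))

/-! ### From local compatibility to a global weight -/

/-- Signed increments of a height function: consecutive selections that differ go up if the later
window sees the earlier selection, and down otherwise. -/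
def heightStep (s : ℕ) (c : ℕ → ℕ) (t : ℕ) : ℤ :=
  if c t = c (t + 1) then 0 else if s * (t + 1) ≤ c t then 1 else -1

def height (s : ℕ) (c : ℕ → ℕ) (t : ℕ) : ℤ := ∑ u ∈ Finset.range t, heightStep s c u

theorem height_succ (s : ℕ) (c : ℕ → ℕ) (t : ℕ) :
    height s c (t + 1) = height s c t + heightStep s c t := Finset.sum_range_succ _ _

theorem neg_le_height (s : ℕ) (c : ℕ → ℕ) (t : ℕ) : -(t : ℤ) ≤ height s c t := by
  induction t with
  | zero => simp [height]
  | succ t ih =>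
    rw [height_succ]
    have : -1 ≤ heightStep s c t := by unfold heightStep; split_ifs <;> omega
    push_cast; omega

/-- A selection `c` of one element in each of the first `n` windows such that consecutive
selections either agree or do not both lie in both windows. -/
structure IsCompatible (s k n : ℕ) (c : ℕ → ℕ) : Prop where
  lower : ∀ i < n, s * i ≤ c i
  upper : ∀ i < n, c i < s * i + k
  step : ∀ i, i + 1 < n → c i = c (i + 1) ∨ c i < s * (i + 1) ∨ s * i + k ≤ c (i + 1)

namespace IsCompatible

variable {s k n : ℕ} {c : ℕ → ℕ}

theorem monotone (h : IsCompatible s k n c) {i j : ℕ} (hij : i ≤ j) (hj : j < n) : c i ≤ c j := by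
  induction j, hij using Nat.le_induction with
  | base => exact le_rfl
  | succ j hij ih =>
    have := ih (by omega)
    have := h.lower (j + 1) hj
    have := h.upper j (by omega)
    rcases h.step j hj with h' | h' | h' <;> omega

/-- By monotonicity all selections between `i` and `j` stay below the end of window `i`, so every
change among them is a step down. -/
theorem height_le_of_lt (h : IsCompatible s k n c) {i j : ℕ} (hij : i ≤ j) (hj : j < n)
    (hc : c j < s * i + k) :
    height s c j ≤ height s c i ∧ (c i ≠ c j → height s c j < height s c i) := by
  induction j, hij using Nat.le_induction with
  | base => simp
  | succ j hij ih =>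
    have h1 := h.monotone (Nat.le_succ j) hj
    obtain ⟨ih1, ih2⟩ := ih (by omega) (lt_of_le_of_lt h1 hc)
    have h2 : s * i ≤ s * j := Nat.mul_le_mul_left s hij
    rw [height_succ]
    by_cases he : c j = c (j + 1)
    · have : heightStep s c j = 0 := by simp [heightStep, he]
      rw [this, ← he]
      simpa using ⟨ih1, ih2⟩
    · have : heightStep s c j = -1 := by
        rw [heightStep, if_neg he, if_neg]
        rcases h.step j hj with h' | h' | h' <;> omega
      rw [this]
      constructor <;> intros <;> omega

/-- Mirror case: the selections in between are at least `c i`, hence seen by the next window, so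
every change is a step up. -/
theorem height_le_of_le (h : IsCompatible s k n c) {i j : ℕ} (hij : i ≤ j) (hj : j < n)
    (hc : s * j ≤ c i) :
    height s c i ≤ height s c j ∧ (c i ≠ c j → height s c i < height s c j) := by
  induction j, hij using Nat.le_induction with
  | base => simp
  | succ j hij ih =>
    have h1 := h.monotone hij (by omega)
    obtain ⟨ih1, ih2⟩ := ih (by omega) (le_trans (Nat.mul_le_mul_left s (Nat.le_succ j)) hc)
    rw [height_succ]
    by_cases he : c j = c (j + 1)
    · have : heightStep s c j = 0 := by simp [heightStep, he]
      rw [this, ← he]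
      simpa using ⟨ih1, ih2⟩
    · have : heightStep s c j = 1 := by
        rw [heightStep, if_neg he, if_pos (hc.trans h1)]
      rw [this]
      constructor <;> intros <;> omega

/-- Makes height a function of the selected index, so the choice of `t` in `exists_weight` is
harmless. -/
theorem height_eq (h : IsCompatible s k n c) {i j : ℕ} (hi : i < n) (hj : j < n)
    (hc : c i = c j) : height s c i = height s c j := by
  wlog hij : i ≤ j generalizing i j
  · exact (this hj hi hc.symm (by omega)).symm
  · exact le_antisymm (h.height_le_of_le hij hj (hc ▸ h.lower j hj)).1
      (h.height_le_of_lt hij hj (hc ▸ h.upper i hi)).1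

/-- A compatible selection is the strict maximizer of some weight on every window. -/
theorem exists_weight (h : IsCompatible s k n c) :
    ∃ w : ℕ → ℤ, ∀ i < n, ∀ j, s * i ≤ j → j < s * i + k → j ≠ c i → w j < w (c i) := by
  classical
  let w : ℕ → ℤ := fun x =>
    if hx : ∃ t, t < n ∧ c t = x then height s c hx.choose else -(n : ℤ)
  have hwc : ∀ i < n, w (c i) = height s c i := by
    intro i hi
    have hx : ∃ t, t < n ∧ c t = c i := ⟨i, hi, rfl⟩
    simp only [w, dif_pos hx]
    exact h.height_eq hx.choose_spec.1 hi hx.choose_spec.2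
  refine ⟨w, fun i hi j hj1 hj2 hne => ?_⟩
  rw [hwc i hi]
  by_cases hx : ∃ t, t < n ∧ c t = j
  · obtain ⟨t, ht, rfl⟩ := hx
    rw [hwc t ht]
    rcases le_total i t with hit | hit
    · exact (h.height_le_of_lt hit ht hj2).2 (Ne.symm hne)
    · exact (h.height_le_of_le hit hi hj1).2 hne
  · simp only [w, dif_neg hx]
    -- Unselected indices weigh `-n`, below every height, since heights are at least `-i > -n`.
    have := neg_le_height s c i
    omega

end IsCompatible

/-! ### Selections as walks of offsets -/

/-- The relation between the offsets of consecutive selections in their windows. -/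
def OffsetStep (s k : ℕ) (a b : Fin k) : Prop :=
  (a : ℕ) < s ∨ k ≤ (b : ℕ) + s ∨ (a : ℕ) = b + s

/-- The walks with `n + 1` vertices of a relation. -/
def relWalks {α : Type*} (R : α → α → Prop) (n : ℕ) : Set (Fin (n + 1) → α) :=
  {f | ∀ i : Fin n, R (f i.castSucc) (f i.succ)}

/-- The selection with given offsets. -/
def offsetSelection (s k m : ℕ) (o : Fin (m + 1) → Fin k) (i : Fin (m + 1)) :
    Fin (s * (m + 1 - 1) + k) :=
  ⟨s * i + o i, by
    have := Nat.mul_le_mul_left s (Nat.le_of_lt_succ i.2)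
    have := (o i).2
    simp only [Nat.add_sub_cancel]
    omega⟩

theorem offsetSelection_injective (s k m : ℕ) : Function.Injective (offsetSelection s k m) := by
  intro o o' h
  funext i
  have := congrArg Fin.val (congrFun h i)
  simp only [offsetSelection] at this
  exact Fin.ext (by omega)

/-- If distinct consecutive selections both lay in both windows, each would have to outweigh the
other; conversely `IsCompatible.exists_weight` supplies the weight. -/
theorem image_offsetSelection (s k m : ℕ) :
    offsetSelection s k m '' relWalks (OffsetStep s k) m =
      {c | ∃ w, ∀ i : Fin (m + 1),
        IsStrictMaximizer w (poolWindow (s * (m + 1 - 1) + k) k s i) (c i)} := by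
  ext c
  constructor
  · rintro ⟨o, ho, rfl⟩
    -- The value 0 past the last window is never inspected by `IsCompatible`.
    let c' : ℕ → ℕ := fun i => if h : i < m + 1 then s * i + o ⟨i, h⟩ else 0
    have hc' : ∀ i (h : i < m + 1), c' i = s * i + o ⟨i, h⟩ := fun i h => dif_pos h
    have hcomp : IsCompatible s k (m + 1) c' := by
      refine ⟨fun i hi => ?_, fun i hi => ?_, fun i hi => ?_⟩
      · rw [hc' i hi]; omega
      · have := (o ⟨i, hi⟩).2
        rw [hc' i hi]; omega
      · rw [hc' i (by omega), hc' (i + 1) hi, mul_add, mul_one]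
        have := ho ⟨i, by omega⟩
        simp only [OffsetStep, Fin.castSucc_mk, Fin.succ_mk] at this
        omega
    obtain ⟨w, hw⟩ := hcomp.exists_weight
    refine ⟨fun j => (w j : ℝ), fun i => ⟨⟨?_, ?_⟩, fun j hj hne => ?_⟩⟩
    · simp [offsetSelection]
    · simp [offsetSelection]
    · have h1 := hw i i.2 j hj.1 hj.2
      rw [hc' i i.2] at h1
      exact Int.cast_lt.2 (h1 fun h => hne (Fin.ext h))
  · rintro ⟨w, hw⟩
    have hlo : ∀ i : Fin (m + 1), s * (i : ℕ) ≤ (c i : ℕ) := fun i => (hw i).1.1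
    have hhi : ∀ i : Fin (m + 1), (c i : ℕ) < s * (i : ℕ) + k := fun i => (hw i).1.2
    refine ⟨fun i => ⟨c i - s * i, by have := hlo i; have := hhi i; omega⟩, fun i => ?_, ?_⟩
    · have h1 := hlo i.castSucc
      have h2 := hlo i.succ
      have h3 := hhi i.castSucc
      have h4 := hhi i.succ
      simp only [Fin.val_castSucc, Fin.val_succ, mul_add, mul_one] at h1 h2 h3 h4
      simp only [OffsetStep, Fin.val_castSucc, Fin.val_succ, mul_add, mul_one]
      by_contra hcon
      push Not at hcon
      obtain ⟨ha, hb, hab⟩ := hcon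
      have hne : c i.castSucc ≠ c i.succ := fun h => by
        have := congrArg Fin.val h
        omega
      have hl := (hw i.castSucc).2 (c i.succ)
        ⟨by simp only [Fin.val_castSucc]; omega, by simp only [Fin.val_castSucc]; omega⟩ hne.symm
      have hr := (hw i.succ).2 (c i.castSucc)
        ⟨by simp only [Fin.val_succ, mul_add, mul_one]; omega,
          by simp only [Fin.val_succ, mul_add, mul_one]; omega⟩ hne
      exact lt_asymm hl hr
    · funext i
      refine Fin.ext ?_
      have := hlo i
      simp only [offsetSelection]
      omega

theorem numVertices_succ_eq_ncard (s k m : ℕ) (hk : 0 < k) :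
    numVertices (m + 1) k s = (relWalks (OffsetStep s k) m).ncard := by
  have hne : ∀ i : Fin (m + 1), (poolWindow (s * (m + 1 - 1) + k) k s i).Nonempty := fun i =>
    ⟨offsetSelection s k m (fun _ => ⟨0, hk⟩) i, by simp [offsetSelection, poolWindow, hk]⟩
  have himg : (poolPolytope (m + 1) k s).exposedPoints ℝ =
      (fun c : Fin (m + 1) → Fin (s * (m + 1 - 1) + k) =>
        ∑ i, (Pi.single (c i) 1 : Fin (s * (m + 1 - 1) + k) → ℝ)) ''
      {c | ∃ w, ∀ i : Fin (m + 1),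
        IsStrictMaximizer w (poolWindow (s * (m + 1 - 1) + k) k s i) (c i)} := by
    ext x
    rw [poolPolytope, Finset.sum_range, mem_exposedPoints_sum_simplexOn hne]
    rfl
  rw [numVertices, himg, (sum_single_injOn _).ncard_image, ← image_offsetSelection,
    Set.ncard_image_of_injective _ (offsetSelection_injective s k m)]

/-! ### Counting walks by blocks of offsets -/

/-- The number of walks of a relation with `n + 1` vertices and a given first vertex. -/
noncomputable def walkCount {α : Type*} (R : α → α → Prop) (n : ℕ) (a : α) : ℕ :=
  Nat.card {f : Fin (n + 1) → α // f 0 = a ∧ f ∈ relWalks R n}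

theorem ncard_relWalks {α : Type*} [Fintype α] (R : α → α → Prop) (n : ℕ) :
    (relWalks R n).ncard = ∑ a, walkCount R n a := by
  classical
  have e : (Σ a, {f : Fin (n + 1) → α // f 0 = a ∧ f ∈ relWalks R n}) ≃ relWalks R n :=
    { toFun := fun p => ⟨p.2.1, p.2.2.2⟩
      invFun := fun f => ⟨f.1 0, f.1, rfl, f.2⟩
      left_inv := by rintro ⟨_, f, rfl, hf⟩; rfl
      right_inv := fun _ => rfl }
  rw [← Nat.card_coe_set_eq, ← Nat.card_congr e, Nat.card_sigma]
  rfl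

theorem walkCount_zero {α : Type*} (R : α → α → Prop) (a : α) : walkCount R 0 a = 1 := by
  rw [walkCount, Nat.card_eq_one_iff_unique]
  refine ⟨⟨fun f g => Subtype.ext (funext fun i => ?_)⟩, ⟨fun _ => a, rfl, fun i => i.elim0⟩⟩
  rw [Fin.fin_one_eq_zero i]
  exact f.2.1.trans g.2.1.symm

open Classical in
theorem walkCount_succ {α : Type*} [Fintype α] (R : α → α → Prop) (n : ℕ) (a : α) :
    walkCount R (n + 1) a = ∑ b, if R a b then walkCount R n b else 0 := by
  let e : {f : Fin (n + 1 + 1) → α // f 0 = a ∧ f ∈ relWalks R (n + 1)} ≃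
      (Σ b : {b // R a b}, {f : Fin (n + 1) → α // f 0 = b ∧ f ∈ relWalks R n}) :=
    { toFun := fun f => ⟨⟨f.1 1, by have := f.2.2 0; simpa [f.2.1] using this⟩,
        Fin.tail f.1, rfl, fun i => by simpa [Fin.tail] using f.2.2 i.succ⟩
      invFun := fun p => ⟨Fin.cons a p.2.1, rfl, fun i => by
        refine Fin.cases ?_ (fun i => ?_) i
        · simpa [p.2.2.1] using p.1.2
        · simpa using p.2.2.2 i⟩
      left_inv := by
        rintro ⟨f, rfl, hf⟩
        exact Subtype.ext (Fin.cons_self_tail f)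
      right_inv := by
        rintro ⟨⟨b, hb⟩, f, hf0, hf⟩
        obtain rfl : f 0 = b := hf0
        rfl }
  rw [walkCount, Nat.card_congr e, Nat.card_sigma, ← Finset.sum_filter]
  exact (Finset.sum_subtype (Finset.univ.filter (R a)) (by simp) (walkCount R n)).symm

/-- The number of offset walks with `n + 1` vertices whose first offset `a` has `a / s = q`. -/
def levelCount (s r : ℕ) : ℕ → ℕ → ℕ
  | 0, _ => 1
  | n + 1, 0 => s * ∑ q ∈ Finset.range (r + 1), levelCount s r n q
  | n + 1, q + 1 => s * levelCount s r n r + levelCount s r n q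

theorem sum_range_mul_div (s m : ℕ) (hs : 0 < s) (g : ℕ → ℕ) :
    ∑ a ∈ Finset.range (s * m), g (a / s) = s * ∑ q ∈ Finset.range m, g q := by
  induction m with
  | zero => simp
  | succ m ih =>
    rw [mul_add, mul_one, Finset.sum_range_add, ih, Finset.sum_range_succ, mul_add]
    congr 1
    rw [Finset.sum_congr rfl (g := fun _ => g m), Finset.sum_const, Finset.card_range, smul_eq_mul]
    intro x hx
    rw [Nat.mul_add_div hs, Nat.div_eq_of_lt (Finset.mem_range.1 hx), add_zero]

theorem sum_fin_div (s r : ℕ) (hs : 0 < s) (g : ℕ → ℕ) :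
    ∑ a : Fin (s * (r + 1)), g ((a : ℕ) / s) = s * ∑ q ∈ Finset.range (r + 1), g q := by
  rw [← sum_range_mul_div s (r + 1) hs, Finset.sum_range]

/-- From block 0 every offset is reachable. From block `q + 1` exactly the `s` offsets of the last
block `r` are, together with `a - s`, which lies in block `q`. -/
theorem walkCount_eq_levelCount (s r : ℕ) (hs : 0 < s) (n : ℕ) (a : Fin (s * (r + 1))) :
    walkCount (OffsetStep s (s * (r + 1))) n a = levelCount s r n ((a : ℕ) / s) := by
  classical
  induction n generalizing a with
  | zero => rw [walkCount_zero, levelCount]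
  | succ n ih =>
    simp only [walkCount_succ, ih]
    by_cases ha : (a : ℕ) < s
    · rw [Nat.div_eq_of_lt ha, levelCount, ← sum_fin_div s r hs]
      exact Finset.sum_congr rfl fun b _ => if_pos (Or.inl ha)
    · push Not at ha
      have hak := a.2
      have hdiv : (a : ℕ) / s = (a - s) / s + 1 := by
        rw [← Nat.add_div_right _ hs, Nat.sub_add_cancel ha]
      let b₀ : Fin (s * (r + 1)) := ⟨a - s, by omega⟩
      have hsplit : ∀ b : Fin (s * (r + 1)),
          (if OffsetStep s (s * (r + 1)) a b then levelCount s r n ((b : ℕ) / s) else 0) =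
          (if r ≤ (b : ℕ) / s then levelCount s r n ((b : ℕ) / s) else 0) +
            (if b = b₀ then levelCount s r n ((b : ℕ) / s) else 0) := by
        intro b
        have h1 : r ≤ (b : ℕ) / s ↔ s * (r + 1) ≤ (b : ℕ) + s := by
          rw [Nat.le_div_iff_mul_le hs, mul_comm r s]
          have := mul_add_one s r
          omega
        have h2 : b = b₀ ↔ (a : ℕ) = b + s := by
          rw [Fin.ext_iff]; simp only [b₀]; omega
        simp only [OffsetStep, h1, h2]
        by_cases hb : s * (r + 1) ≤ (b : ℕ) + s
        · have : (a : ℕ) ≠ b + s := by omega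
          simp [hb, this]
        · simp [hb, not_lt.2 ha]
      rw [Finset.sum_congr rfl fun b _ => hsplit b, Finset.sum_add_distrib,
        sum_fin_div s r hs fun q => if r ≤ q then levelCount s r n q else 0, hdiv, levelCount,
        Finset.sum_range_succ, Finset.sum_eq_zero fun q hq => if_neg (by simpa using hq)]
      simp [b₀]

/-- An initial offset in block 0 leaves the next one free, so prepending it turns the count of all
walks into a single level count. -/
theorem numVertices_succ_eq_levelCount (s r : ℕ) (hs : 0 < s) (m : ℕ) :
    numVertices (m + 1) (s * (r + 1)) s = levelCount s r (m + 1) 0 := by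
  rw [numVertices_succ_eq_ncard _ _ _ (by positivity), ncard_relWalks, levelCount,
    ← sum_fin_div s r hs]
  exact Finset.sum_congr rfl fun a _ => walkCount_eq_levelCount s r hs m a

/-! ### Solving for the generating function -/

noncomputable def levelGenFun (s r q : ℕ) : PowerSeries ℚ :=
  PowerSeries.mk fun n => (levelCount s r n q : ℚ)

theorem vertexGenFun_eq_levelGenFun (s r : ℕ) (hs : 0 < s) :
    vertexGenFun (s * (r + 1)) s = levelGenFun s r 0 := by
  ext n
  cases n with
  | zero => simp [vertexGenFun, levelGenFun, levelCount]
  | succ n => simp [vertexGenFun, levelGenFun, numVertices_succ_eq_levelCount s r hs]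

section GenFun

open PowerSeries

theorem coeff_succ_X_mul_natCast_mul (s n : ℕ) (f : ℚ⟦X⟧) :
    coeff (n + 1) (X * ((s : ℚ⟦X⟧) * f)) = s * coeff n f := by
  rw [coeff_succ_X_mul, ← map_natCast (C (R := ℚ)), coeff_C_mul]

theorem levelGenFun_zero (s r : ℕ) :
    levelGenFun s r 0 =
      1 + X * ((s : ℚ⟦X⟧) * ∑ q ∈ Finset.range (r + 1), levelGenFun s r q) := by
  ext n
  cases n with
  | zero => simp [levelGenFun, levelCount]
  | succ n =>
    rw [map_add, coeff_succ_X_mul_natCast_mul]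
    simp [levelGenFun, levelCount, coeff_one]

theorem levelGenFun_succ (s r q : ℕ) :
    levelGenFun s r (q + 1) =
      1 + X * ((s : ℚ⟦X⟧) * levelGenFun s r r) + X * levelGenFun s r q := by
  ext n
  cases n with
  | zero => simp [levelGenFun, levelCount]
  | succ n =>
    rw [map_add, map_add, coeff_succ_X_mul_natCast_mul, coeff_succ_X_mul]
    simp [levelGenFun, levelCount, coeff_one]

/-- Iterating `levelGenFun_succ` produces a geometric sum; the factor `1 - X` clears its
denominator. -/
theorem one_sub_X_mul_levelGenFun (s r q : ℕ) :
    (1 - X) * levelGenFun s r q = (1 + X * ((s : ℚ⟦X⟧) * levelGenFun s r r)) * (1 - X ^ q) +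
      (1 - X) * X ^ q * levelGenFun s r 0 := by
  induction q with
  | zero => ring
  | succ q ih => linear_combination (1 - X) * levelGenFun_succ s r q + X * ih

theorem one_sub_X_sq_mul_sum_levelGenFun (s r m : ℕ) :
    (1 - X) ^ 2 * ∑ q ∈ Finset.range m, levelGenFun s r q =
      (1 + X * ((s : ℚ⟦X⟧) * levelGenFun s r r)) * ((m : ℚ⟦X⟧) * (1 - X) - (1 - X ^ m)) +
        (1 - X) * (1 - X ^ m) * levelGenFun s r 0 := by
  induction m with
  | zero => simp
  | succ m ih =>
    rw [Finset.sum_range_succ]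
    push_cast
    linear_combination ih + (1 - X) * one_sub_X_mul_levelGenFun s r m

theorem levelGenFun_zero_mul (s r : ℕ) :
    levelGenFun s r 0 *
      (1 - 2 * ((s : ℚ⟦X⟧) + 1) * X + ((s : ℚ⟦X⟧) + 1) ^ 2 * X ^ 2 + (s : ℚ⟦X⟧) * X ^ (r + 1)
        - (s : ℚ⟦X⟧) ^ 2 * ((r : ℚ⟦X⟧) + 1) * X ^ (r + 2)
        + (s : ℚ⟦X⟧) * ((r : ℚ⟦X⟧) * (s : ℚ⟦X⟧) - 1) * X ^ (r + 3)) =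
      1 + ((r : ℚ⟦X⟧) * (s : ℚ⟦X⟧) - (s : ℚ⟦X⟧) - 2) * X
        - ((r : ℚ⟦X⟧) * (s : ℚ⟦X⟧) - 1) * X ^ 2 + (s : ℚ⟦X⟧) * X ^ (r + 1) := by
  have hX : (1 - X : ℚ⟦X⟧) ≠ 0 := fun h => by
    have := congrArg (constantCoeff (R := ℚ)) h
    simp at this
  have h0 := levelGenFun_zero s r
  have hr := one_sub_X_mul_levelGenFun s r r
  have hsum := one_sub_X_sq_mul_sum_levelGenFun s r (r + 1)
  push_cast at hsum
  refine mul_left_cancel₀ hX ?_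
  generalize levelGenFun s r 0 = F at *
  generalize levelGenFun s r r = V at *
  generalize ∑ q ∈ Finset.range (r + 1), levelGenFun s r q = S at *
  generalize (s : ℚ⟦X⟧) = σ at *
  generalize (r : ℚ⟦X⟧) = ρ at *
  -- Two linear equations in `F` and `1 + X * (σ * V)`; the final combination eliminates the latter.
  have hF : (1 - X) ^ 2 * F = (1 - X) ^ 2 + X * σ *
      ((1 + X * (σ * V)) * ((ρ + 1) * (1 - X) - (1 - X ^ (r + 1))) +
        (1 - X) * (1 - X ^ (r + 1)) * F) := by
    linear_combination (1 - X) ^ 2 * h0 + X * σ * hsum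
  have hG : (1 - (σ + 1) * X + σ * X ^ (r + 1)) * (1 + X * (σ * V)) =
      (1 - X) * (1 + σ * X ^ (r + 1) * F) := by
    linear_combination X * σ * hr
  linear_combination (1 - (σ + 1) * X + σ * X ^ (r + 1)) * hF +
    X * σ * (ρ - (ρ + 1) * X + X ^ (r + 1)) * hG

end GenFun

open PowerSeries in
/-- Both denominators have constant coefficient `1`, so `⁻¹` is the true inverse of a formal power
series. -/
theorem theorem4p2 (s r k : ℕ) (hs : 0 < s) (hr : 0 < r) (hk : k = s * (r + 1)) :
    (vertexGenFun k s =
      (1 + ((r : ℚ⟦X⟧) * (s : ℚ⟦X⟧) - (s : ℚ⟦X⟧) - 2) * X - ((r : ℚ⟦X⟧) * (s : ℚ⟦X⟧) - 1) * X ^ 2 + (s : ℚ⟦X⟧) * X ^ (r + 1)) *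
      (1 - 2 * ((s : ℚ⟦X⟧) + 1) * X + ((s : ℚ⟦X⟧) + 1) ^ 2 * X ^ 2 + (s : ℚ⟦X⟧) * X ^ (r + 1)
        - (s : ℚ⟦X⟧) ^ 2 * ((r : ℚ⟦X⟧) + 1) * X ^ (r + 2)
        + (s : ℚ⟦X⟧) * ((r : ℚ⟦X⟧) * (s : ℚ⟦X⟧) - 1) * X ^ (r + 3))⁻¹) ∧
    (s = 1 → vertexGenFun k 1 =
      (1 + ((k : ℚ⟦X⟧) - 4) * X - ((k : ℚ⟦X⟧) - 2) * X ^ 2 + X ^ k) *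
      (1 - 4 * X + 4 * X ^ 2 + X ^ k - (k : ℚ⟦X⟧) * X ^ (k + 1)
        + ((k : ℚ⟦X⟧) - 2) * X ^ (k + 2))⁻¹) := by
  have h1 : ∀ s r : ℕ, 0 < s → vertexGenFun (s * (r + 1)) s =
      (1 + ((r : ℚ⟦X⟧) * (s : ℚ⟦X⟧) - (s : ℚ⟦X⟧) - 2) * X - ((r : ℚ⟦X⟧) * (s : ℚ⟦X⟧) - 1) * X ^ 2 + (s : ℚ⟦X⟧) * X ^ (r + 1)) *
      (1 - 2 * ((s : ℚ⟦X⟧) + 1) * X + ((s : ℚ⟦X⟧) + 1) ^ 2 * X ^ 2 + (s : ℚ⟦X⟧) * X ^ (r + 1)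
        - (s : ℚ⟦X⟧) ^ 2 * ((r : ℚ⟦X⟧) + 1) * X ^ (r + 2)
        + (s : ℚ⟦X⟧) * ((r : ℚ⟦X⟧) * (s : ℚ⟦X⟧) - 1) * X ^ (r + 3))⁻¹ := by
    intro s r hs
    rw [PowerSeries.eq_mul_inv_iff_mul_eq (by simp), vertexGenFun_eq_levelGenFun s r hs,
      levelGenFun_zero_mul]
  subst hk
  refine ⟨h1 s r hs, ?_⟩
  rintro rfl
  rw [one_mul]
  have h2 := h1 1 r one_pos
  rw [one_mul] at h2
  rw [h2]
  congr 1
  · push_cast; ring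
  · congr 1
    push_cast; ring
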